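/- Let $m\ge 2$ and $n\ge 1$ be integers, and put $\zeta_m=e^{2\pi\sqrt{-1}/m}$. A function $f:\mathbb Z_2^n\to\mathbb Z_m$ is an $(m,n)$-generalized bent function ($(m,n)$-GBF) if $$\Big|\sum_{x\in\mathbb Z_2^n}\zeta_m^{f(x)}(-1)^{y\cdot x}\Big|^2=2^n\quad\text{for all } y\in\mathbb Z_2^n .$$ Let $C_m=\langle g\rangle$ be cyclic of order $m$, and let $\mathbb N[C_m]$ be the set of formal sums $D=\sum_{i=0}^{m-1}d_ig^i$ with integers $d_i\ge 0$. For a character $\tau$ of $C_m$ put $\tau(D)=\sum_i d_i\tau(g)^i$. Call $D$ a *v-sum* if $\tau(D)=0$ for some character $\tau$ of order $m$. Call $D$ a *minimal v-sum* if $D\ne 0$ and there is a character $\tau$ of order $m$ with $\tau(D)=0$ and $\tau(\sum_i b_ig^i)\neq0$ whenever $0\le b_i\le d_i$ for all $i$, $b_j<d_j$ for some $j$, and not all $b_i$ are $0$. The *reduced exponent* of a minimal v-sum $D$ is the smallest positive integer $k$ such that, for some $j$ with $d_j\ne0$, one has $(\tau(g)^{i}\tau(g)^{-j})^k=1$ for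 all $i$ with $d_i\neq 0$, where $\tau$ is a character of order $m$ (the choice of $\tau$ does not matter). The *c-exponent* of a v-sum $D$ is the smallest $k$ such that $D=D_1+\dots+D_t$ for some minimal v-sums $D_1,\dots,D_t\in\mathbb N[C_m]$ with reduced exponents $k_1,\dots,k_t$ satisfying $\operatorname{lcm}(k_1,\dots,k_t)=k$. **Proposition.** Let $f$ be an $(m,n)$-GBF, where $m=\prod_{i=1}^s p_i^{\alpha_i}$ with distinct primes $p_i$ and $\alpha_i\ge1$. For each $x\in\mathbb Z_2^n$ with $x\ne 0$ let $k_x$ be the c-exponent of the v-sum $E_x=\sum_{y\in\mathbb Z_2^n}g^{f(y+x)}g^{-f(y)}\in\mathbb N[C_m]$. Set $$I=\{1\le i\le s:\ p_i\nmid k_x\ \text{ for all } x\neq 0\},\qquad \overline m=\prod_{i\notin I}p_i^{\alpha_i}.$$ Then there exists an $(\overline m,n)$-GBF. In particular, if $p$ is a prime with $p\mid m$ and $p>2^n$, then there exists an $(m/p,n)$-GBF. -/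

import Mathlib

namespace GBF

/-- The elements of the group `ℤ_2^n`, written additively (so `1_G` is `0`). -/
abbrev Cube (n : ℕ) : Type := Fin n → ZMod 2

/-- The semiring `ℕ[C_m]`: formal sums, with nonnegative integer coefficients, of elements of the
cyclic group `C_m` of order `m`. The element `g ^ i` of `C_m = ⟨g⟩` is represented by
`i : ZMod m`. -/
abbrev NatGroupRing (m : ℕ) : Type := AddMonoidAlgebra ℕ (ZMod m)

/-- `F(y) = ∑_x ζ_m ^ f(x) * (-1) ^ (y ⬝ x)`, where `ζ_m = exp (2 π i / m)`. -/
noncomputable def walsh {m n : ℕ} (f : Cube n → ZMod m) (y : Cube n) : ℂ :=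
  ∑ x : Cube n, Complex.exp (2 * Real.pi * Complex.I / m) ^ (f x).val *
    (-1 : ℂ) ^ (dotProduct y x).val

/-- `f : ℤ_2^n → ℤ_m` is an `(m, n)`-generalized bent function, where `m ≥ 2` and `n ≥ 1`. -/
structure IsGBF (m n : ℕ) (f : Cube n → ZMod m) : Prop where
  two_le : 2 ≤ m
  n_pos : 1 ≤ n
  norm_sq : ∀ y : Cube n, ‖walsh f y‖ ^ 2 = 2 ^ n

/-- `E_x = ∑_y g ^ f(y + x) * g ^ (-f(y))`, an element of `ℕ[C_m]`. -/
noncomputable def E {m n : ℕ} (f : Cube n → ZMod m) (x : Cube n) : NatGroupRing m :=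
  ∑ y : Cube n, AddMonoidAlgebra.single (f (y + x) - f y) 1

/-- `τ(D) = ∑_i d_i τ(g ^ i)` for a character `τ` of `C_m` and `D = ∑_i d_i g ^ i`. -/
noncomputable def charSum {m : ℕ} (τ : AddChar (ZMod m) ℂ) (D : NatGroupRing m) : ℂ :=
  D.coeff.sum fun i d => (d : ℂ) * τ i

/-- `D` is a v-sum: some character of order `m` sends it to `0`. -/
def IsVSum {m : ℕ} (D : NatGroupRing m) : Prop :=
  ∃ τ : AddChar (ZMod m) ℂ, orderOf τ = m ∧ charSum τ D = 0

/-- `D` is a minimal v-sum: it is nonzero, some character `τ` of order `m` sends it to `0`, and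
`τ` does not send to `0` any `B` with `B ≤ D` coefficientwise other than `0` and `D`. -/
def IsMinimalVSum {m : ℕ} (D : NatGroupRing m) : Prop :=
  D ≠ 0 ∧ ∃ τ : AddChar (ZMod m) ℂ, orderOf τ = m ∧ charSum τ D = 0 ∧
    ∀ B : NatGroupRing m, B ≠ 0 → B ≠ D → (∀ i, B.coeff i ≤ D.coeff i) → charSum τ B ≠ 0

/-- The reduced exponent of `D`: the smallest positive `k` such that, for some `j` in the support,
`(τ(g ^ i) * τ(g ^ j)⁻¹) ^ k = 1` for all `i` in the support of `D`, where `τ` is a character of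
order `m`. As such a `τ` is injective, the condition is the same for all `τ` of order `m`. -/
noncomputable def reducedExponent {m : ℕ} (D : NatGroupRing m) : ℕ :=
  sInf {k : ℕ | 0 < k ∧ ∃ τ : AddChar (ZMod m) ℂ, orderOf τ = m ∧
    ∃ j ∈ D.coeff.support, ∀ i ∈ D.coeff.support, (τ i * (τ j)⁻¹) ^ k = 1}

/-- The numbers `lcm(k_1, …, k_t)` that arise from the decompositions `D = D_1 + ⋯ + D_t` of `D`
into minimal v-sums, where `k_i` is the reduced exponent of `D_i`. -/
def decompositionExponents {m : ℕ} (D : NatGroupRing m) : Set ℕ :=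
  {k : ℕ | ∃ s : Multiset (NatGroupRing m),
    (∀ A ∈ s, IsMinimalVSum A) ∧ s.sum = D ∧ (s.map reducedExponent).lcm = k}

/-- The c-exponent of a v-sum `D`: the smallest element of `decompositionExponents D`, a set which
is nonempty for every v-sum `D` (`decompositionExponents_nonempty`). -/
noncomputable def cExponent {m : ℕ} (D : NatGroupRing m) : ℕ :=
  sInf (decompositionExponents D)

theorem charSum_add {m : ℕ} (τ : AddChar (ZMod m) ℂ) (A B : NatGroupRing m) :
    charSum τ (A + B) = charSum τ A + charSum τ B := by
  unfold charSum
  rw [AddMonoidAlgebra.coeff_add]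
  exact Finsupp.sum_add_index' (by simp) (by intros; push_cast; ring)

theorem decompositionExponents_nonempty {m : ℕ} {D : NatGroupRing m} (hD : IsVSum D) :
    (decompositionExponents D).Nonempty := by
  obtain ⟨τ, hτ, h0⟩ := hD
  suffices H : ∀ N : ℕ, ∀ D : NatGroupRing m, D.coeff.degree = N → charSum τ D = 0 →
      ∃ s : Multiset (NatGroupRing m), (∀ A ∈ s, IsMinimalVSum A) ∧ s.sum = D by
    obtain ⟨s, hs, hsum⟩ := H _ D rfl h0
    exact ⟨_, s, hs, hsum, rfl⟩
  intro N
  induction N using Nat.strong_induction_on with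
  | _ N ih =>
    intro D hN h0
    by_cases hz : D = 0
    · exact ⟨0, by simp, by simp [hz]⟩
    by_cases hmin : IsMinimalVSum D
    · exact ⟨{D}, by simpa using hmin, by simp⟩
    have hex : ∃ B : NatGroupRing m, B ≠ 0 ∧ B ≠ D ∧ (∀ i, B.coeff i ≤ D.coeff i) ∧
        charSum τ B = 0 := by
      by_contra hcon
      push Not at hcon
      exact hmin ⟨hz, τ, hτ, h0, fun B h1 h2 h3 => hcon B h1 h2 h3⟩
    obtain ⟨B, hB0, hBD, hle, hB⟩ := hex
    obtain ⟨C, hC⟩ : ∃ C : NatGroupRing m, B + C = D := by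
      refine ⟨.ofCoeff (D.coeff - B.coeff), ?_⟩
      apply AddMonoidAlgebra.coeff_injective
      rw [AddMonoidAlgebra.coeff_add, AddMonoidAlgebra.coeff_ofCoeff]
      exact add_tsub_cancel_of_le (Finsupp.le_def.2 hle)
    have hC0 : C ≠ 0 := by
      rintro rfl
      exact hBD (by simpa using hC)
    have hCs : charSum τ C = 0 := by
      have := charSum_add τ B C
      rw [hC, h0, hB] at this
      simpa using this.symm
    have hdeg : B.coeff.degree + C.coeff.degree = N := by
      rw [← hN, ← hC, AddMonoidAlgebra.coeff_add, map_add]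
    have hBd : B.coeff.degree ≠ 0 := by
      rw [Ne, Finsupp.degree_eq_zero_iff]
      simpa using hB0
    have hCd : C.coeff.degree ≠ 0 := by
      rw [Ne, Finsupp.degree_eq_zero_iff]
      simpa using hC0
    obtain ⟨s, hs, hsB⟩ := ih _ (by omega) B rfl hB
    obtain ⟨t, ht, htC⟩ := ih _ (by omega) C rfl hCs
    refine ⟨s + t, ?_, by rw [Multiset.sum_add, hsB, htC, hC]⟩
    intro A hA
    rcases Multiset.mem_add.1 hA with h | h
    · exact hs A h
    · exact ht A h

end GBF

/-! By Fourier inversion on the cube, a unimodular function has flat spectrum iff its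
autocorrelations off `0` vanish (`norm_sq_walshSum_eq_iff`). So `f` is a GBF iff a character of
order `m` kills every `E f x` with `x ≠ 0`, and by Galois conjugacy then all such characters do. To
lower the modulus to `M` it suffices to find one character `ρ` with `ρ ^ M = 1` that still kills
every such `E f x` (`exists_isGBF_of_addChar`).

Both claims take `ρ` to be a power of a character `τ` of order `m`. If `m = M * q` with coprime
factors and the c-exponents are coprime to `q`, take `e ≡ 1` mod `M`, `e ≡ 0` mod `q`: on each
minimal summand `τ ^ e` is `τ` up to a scalar. If `p > 2 ^ n`, enough powers of `τ` of order `m`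
kill `E f x` for a Vandermonde-type argument to reach a power of order prime to `p`. -/

namespace GBF

open Polynomial

/-! ### Characters of order `m` and Galois conjugacy. -/

section Characters

variable {m : ℕ}

theorem addChar_apply_eq_pow [NeZero m] (τ : AddChar (ZMod m) ℂ) (i : ZMod m) :
    τ i = τ 1 ^ i.val := by
  rw [← AddChar.map_nsmul_eq_pow, nsmul_eq_mul, mul_one, ZMod.natCast_zmod_val]

theorem isPrimitiveRoot_of_orderOf [NeZero m] {τ : AddChar (ZMod m) ℂ} (hτ : orderOf τ = m) :
    IsPrimitiveRoot (τ 1) m := by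
  have h : orderOf (τ 1) = orderOf τ := by
    refine orderOf_eq_orderOf_iff.2 fun k => ⟨fun h => ?_, fun h => ?_⟩
    · ext i
      rw [AddChar.pow_apply, addChar_apply_eq_pow, ← pow_mul, mul_comm, pow_mul, h, one_pow,
        AddChar.one_apply]
    · rw [← AddChar.pow_apply, h, AddChar.one_apply]
  have h1 := IsPrimitiveRoot.orderOf (τ 1)
  rwa [h, hτ] at h1

theorem eq_zero_of_addChar_eq_one [NeZero m] {τ : AddChar (ZMod m) ℂ} (hτ : orderOf τ = m)
    {i : ZMod m} (hi : τ i = 1) : i = 0 := by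
  rw [addChar_apply_eq_pow, (isPrimitiveRoot_of_orderOf hτ).pow_eq_one_iff_dvd] at hi
  exact (ZMod.val_eq_zero i).1 (Nat.eq_zero_of_dvd_of_lt hi i.val_lt)

/-- Whether a character of order `m` kills `D` does not depend on the character. -/
theorem charSum_eq_zero_of_orderOf [NeZero m] {τ σ : AddChar (ZMod m) ℂ} (hτ : orderOf τ = m)
    (hσ : orderOf σ = m) {D : NatGroupRing m} (h : charSum τ D = 0) : charSum σ D = 0 := by
  let P : ℤ[X] := D.coeff.sum fun i d => C (d : ℤ) * X ^ i.val
  have key : ∀ ρ : AddChar (ZMod m) ℂ, aeval (ρ 1) P = charSum ρ D := by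
    intro ρ
    simp only [P, charSum, Finsupp.sum, map_sum, map_mul, map_pow, aeval_X, aeval_C]
    refine Finset.sum_congr rfl fun i _ => ?_
    rw [addChar_apply_eq_pow ρ i]
    simp
  have hpos := NeZero.pos m
  -- The cyclotomic polynomial is the minimal polynomial of both `τ 1` and `σ 1`, so divisibility
  -- transfers the zero.
  have hdvd : cyclotomic m ℤ ∣ P := by
    rw [cyclotomic_eq_minpoly (isPrimitiveRoot_of_orderOf hτ) hpos]
    exact minpoly.isIntegrallyClosed_dvd ((isPrimitiveRoot_of_orderOf hτ).isIntegral hpos)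
      (by rw [key, h])
  rw [cyclotomic_eq_minpoly (isPrimitiveRoot_of_orderOf hσ) hpos] at hdvd
  obtain ⟨Q, hQ⟩ := hdvd
  rw [← key, hQ, map_mul, minpoly.aeval, zero_mul]

theorem charSum_multiset_sum (τ : AddChar (ZMod m) ℂ) (s : Multiset (NatGroupRing m)) :
    charSum τ s.sum = (s.map (charSum τ)).sum := by
  let φ : NatGroupRing m →+ ℂ :=
    { toFun := charSum τ, map_zero' := by simp [charSum], map_add' := charSum_add τ }
  exact map_multiset_sum φ s

theorem charSum_E {n : ℕ} (τ : AddChar (ZMod m) ℂ) (f : Cube n → ZMod m) (x : Cube n) :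
    charSum τ (E f x) = ∑ y : Cube n, τ (f (y + x) - f y) := by
  let φ : NatGroupRing m →+ ℂ :=
    { toFun := charSum τ, map_zero' := by simp [charSum], map_add' := charSum_add τ }
  have h : φ (E f x) = ∑ y : Cube n, φ (AddMonoidAlgebra.single (f (y + x) - f y) 1) :=
    map_sum φ _ _
  refine h.trans (Finset.sum_congr rfl fun y _ => ?_)
  change charSum τ _ = _
  simp [charSum]

theorem exists_addChar_of_isPrimitiveRoot [NeZero m] {ζ : ℂ} (hζ : IsPrimitiveRoot ζ m) :
    ∃ τ : AddChar (ZMod m) ℂ, orderOf τ = m ∧ ∀ i : ZMod m, τ i = ζ ^ i.val := by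
  refine ⟨AddChar.zmodChar m hζ.pow_eq_one, ?_, fun i => AddChar.zmodChar_apply _ i⟩
  have h1 : AddChar.zmodChar m hζ.pow_eq_one ((1 : ℕ) : ZMod m) = ζ := by
    rw [AddChar.zmodChar_apply', pow_one]
  refine Nat.dvd_antisymm (orderOf_dvd_of_pow_eq_one ?_) (hζ.dvd_of_pow_eq_one _ ?_)
  · ext i
    rw [AddChar.pow_apply, AddChar.zmodChar_apply, ← pow_mul, mul_comm, pow_mul,
      hζ.pow_eq_one, one_pow, AddChar.one_apply]
  · refine (congrArg (· ^ _) h1).symm.trans ?_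
    rw [← AddChar.pow_apply, pow_orderOf_eq_one, AddChar.one_apply]

end Characters

/-! ### Flat spectra and autocorrelation. -/

section Walsh

variable {m n : ℕ}

theorem neg_one_pow_val_add (a b : ZMod 2) :
    (-1 : ℂ) ^ (a + b).val = (-1) ^ a.val * (-1) ^ b.val := by
  have h : ∀ a b : ZMod 2, (-1 : ℤ) ^ (a + b).val = (-1) ^ a.val * (-1) ^ b.val := by decide
  exact_mod_cast congrArg (Int.cast : ℤ → ℂ) (h a b)

theorem sum_neg_one_pow_dotProduct (z : Cube n) :
    ∑ y : Cube n, (-1 : ℂ) ^ (dotProduct y z).val = if z = 0 then 2 ^ n else 0 := by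
  split_ifs with hz
  · simp [hz, ZMod.card]
  · obtain ⟨i, hi⟩ := Function.ne_iff.1 hz
    have hi1 : z i = 1 := (by decide : ∀ a : ZMod 2, a ≠ 0 → a = 1) (z i) hi
    -- Translating by a basis vector on which `z` is `1` flips every sign, so the sum equals its
    -- negative.
    have h := Equiv.sum_comp (Equiv.addRight (Pi.single i 1 : Cube n))
      fun y : Cube n => (-1 : ℂ) ^ (dotProduct y z).val
    simp only [Equiv.coe_addRight, add_dotProduct, neg_one_pow_val_add, single_one_dotProduct, hi1,
      ZMod.val_one, pow_one, ← Finset.sum_mul] at h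
    linear_combination (-1 / 2 : ℂ) * h

theorem neg_one_pow_val_mul_self (a : ZMod 2) : (-1 : ℂ) ^ a.val * (-1) ^ a.val = 1 := by
  rw [← mul_pow]
  simp

/-- The squared modulus of the Walsh transform is the transform of the autocorrelation. -/
theorem norm_sq_walshSum (φ : Cube n → ℂ) (y : Cube n) :
    ((‖∑ x, φ x * (-1 : ℂ) ^ (dotProduct y x).val‖ ^ 2 : ℝ) : ℂ) =
      ∑ z : Cube n, (∑ x, φ (x + z) * starRingEnd ℂ (φ x)) * (-1) ^ (dotProduct y z).val := by
  push_cast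
  rw [← Complex.mul_conj', map_sum, Finset.sum_mul_sum, Finset.sum_comm]
  simp_rw [Finset.sum_mul]
  conv_rhs => rw [Finset.sum_comm]
  refine Finset.sum_congr rfl fun x _ => ?_
  rw [← Equiv.sum_comp (Equiv.addLeft x)]
  refine Finset.sum_congr rfl fun z _ => ?_
  simp only [Equiv.coe_addLeft, dotProduct_add, neg_one_pow_val_add, map_mul, map_pow, map_neg,
    map_one]
  linear_combination (φ (x + z) * starRingEnd ℂ (φ x) * (-1 : ℂ) ^ (dotProduct y z).val) *
    neg_one_pow_val_mul_self (dotProduct y x)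

/-- A unimodular function on the cube has flat spectrum iff its autocorrelation vanishes away
from `0`. -/
theorem norm_sq_walshSum_eq_iff (φ : Cube n → ℂ) (hφ : ∀ x, φ x * starRingEnd ℂ (φ x) = 1) :
    (∀ y : Cube n, ‖∑ x, φ x * (-1 : ℂ) ^ (dotProduct y x).val‖ ^ 2 = (2 : ℝ) ^ n) ↔
      ∀ z : Cube n, z ≠ 0 → ∑ x, φ (x + z) * starRingEnd ℂ (φ x) = 0 := by
  constructor
  · intro h z hz
    set A : Cube n → ℂ := fun z => ∑ x, φ (x + z) * starRingEnd ℂ (φ x) with hA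
    have hy : ∀ y : Cube n, ∑ w, A w * (-1 : ℂ) ^ (dotProduct y w).val = 2 ^ n := by
      intro y
      rw [hA, ← norm_sq_walshSum, h y]
      push_cast
      rfl
    -- Fourier inversion: the transform of `A` is constant, so `A` is supported at `0`.
    have h1 : ∑ y : Cube n, (∑ w, A w * (-1 : ℂ) ^ (dotProduct y w).val) *
        (-1) ^ (dotProduct y z).val = 0 := by
      simp_rw [hy]
      rw [← Finset.mul_sum, sum_neg_one_pow_dotProduct, if_neg hz, mul_zero]
    have h2 : ∑ y : Cube n, (∑ w, A w * (-1 : ℂ) ^ (dotProduct y w).val) *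
        (-1) ^ (dotProduct y z).val = A z * 2 ^ n := by
      simp_rw [Finset.sum_mul, mul_assoc, ← neg_one_pow_val_add, ← dotProduct_add]
      rw [Finset.sum_comm]
      simp_rw [← Finset.mul_sum, sum_neg_one_pow_dotProduct]
      have hwz : ∀ w : Cube n, w + z = 0 ↔ w = z := by
        intro w
        rw [add_eq_zero_iff_eq_neg, show -z = z from funext fun i => CharTwo.neg_eq (z i)]
      simp [hwz]
    rw [h2] at h1
    exact (mul_eq_zero.1 h1).resolve_right (pow_ne_zero _ two_ne_zero)
  · intro h y
    have h1 := (norm_sq_walshSum φ y).trans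
      (Finset.sum_eq_single (0 : Cube n) (fun z _ hz => by rw [h z hz, zero_mul]) (by simp))
    simp only [add_zero, hφ, dotProduct_zero, ZMod.val_zero, pow_zero, mul_one] at h1
    simp only [Finset.sum_const, Finset.card_univ, Fintype.card_pi, ZMod.card, Finset.prod_const,
      Fintype.card_fin, nsmul_eq_mul, mul_one] at h1
    exact_mod_cast h1

theorem addChar_sub_eq [NeZero m] (τ : AddChar (ZMod m) ℂ) (a b : ZMod m) :
    τ (a - b) = τ a * starRingEnd ℂ (τ b) := by
  rw [AddChar.map_sub_eq_div, div_eq_mul_inv, AddChar.inv_apply_eq_conj]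

theorem addChar_mul_conj [NeZero m] (τ : AddChar (ZMod m) ℂ) (a : ZMod m) :
    τ a * starRingEnd ℂ (τ a) = 1 := by
  rw [← addChar_sub_eq, sub_self, AddChar.map_zero_eq_one]

/-- For a generalized bent function, every `E_x` with `x ≠ 0` is killed by every character of
order `m`. -/
theorem IsGBF.charSum_E_eq_zero [NeZero m] {f : Cube n → ZMod m} (hf : IsGBF m n f)
    {τ : AddChar (ZMod m) ℂ} (hτ : orderOf τ = m) {x : Cube n} (hx : x ≠ 0) :
    charSum τ (E f x) = 0 := by
  obtain ⟨σ, hσ, hval⟩ := exists_addChar_of_isPrimitiveRoot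
    (Complex.isPrimitiveRoot_exp m (NeZero.ne m))
  refine charSum_eq_zero_of_orderOf hσ hτ ?_
  have h := (norm_sq_walshSum_eq_iff (fun x => σ (f x)) fun x => addChar_mul_conj σ (f x)).1
    (by simpa only [walsh, ← hval] using hf.norm_sq) x hx
  rw [charSum_E]
  simpa only [addChar_sub_eq] using h

/-- A character of `ZMod m` of exponent `M` killing all `E_x` with `x ≠ 0` yields an
`(M, n)`-generalized bent function. -/
theorem exists_isGBF_of_addChar [NeZero m] {M : ℕ} (hM : M ≠ 0) (hn : 1 ≤ n)
    (f : Cube n → ZMod m) (ρ : AddChar (ZMod m) ℂ) (hρ : ρ ^ M = 1)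
    (h : ∀ x : Cube n, x ≠ 0 → charSum ρ (E f x) = 0) :
    ∃ f' : Cube n → ZMod M, IsGBF M n f' := by
  have : NeZero M := ⟨hM⟩
  have hpow : ∀ i, ρ i ^ M = 1 := fun i => by
    rw [← AddChar.pow_apply, hρ, AddChar.one_apply]
  -- For `M = 1` the character is trivial and sends `E f x` to `2 ^ n ≠ 0`; a nonzero `x` exists
  -- because `n ≥ 1`.
  have hM2 : 2 ≤ M := by
    by_contra hlt
    obtain rfl : M = 1 := by omega
    obtain rfl : ρ = 1 := by simpa using hρ
    have : Nonempty (Fin n) := ⟨⟨0, hn⟩⟩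
    obtain ⟨x, hx⟩ := exists_ne (0 : Cube n)
    have := h x hx
    rw [charSum_E] at this
    simp [ZMod.card] at this
  have hprim := Complex.isPrimitiveRoot_exp M hM
  choose k hkM hk using fun i => hprim.eq_pow_of_pow_eq_one (hpow i)
  refine ⟨fun x => (k (f x) : ZMod M), hM2, hn, fun y => ?_⟩
  have h1 := (norm_sq_walshSum_eq_iff (fun x => ρ (f x)) fun x => addChar_mul_conj ρ (f x)).2
    (fun z hz => by simpa only [charSum_E, addChar_sub_eq] using h z hz) y
  rw [← h1, walsh]
  simp_rw [ZMod.val_natCast_of_lt (hkM _), hk]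

end Walsh

/-! ### Lowering the modulus. -/

section Reduction

variable {m n : ℕ}

theorem reducedExponent_spec [NeZero m] {D : NatGroupRing m} (hD : IsMinimalVSum D) :
    ∃ τ : AddChar (ZMod m) ℂ, orderOf τ = m ∧
      ∃ j ∈ D.coeff.support, ∀ i ∈ D.coeff.support, (τ i * (τ j)⁻¹) ^ reducedExponent D = 1 := by
  refine (Nat.sInf_mem (s := {k : ℕ | 0 < k ∧ ∃ τ : AddChar (ZMod m) ℂ, orderOf τ = m ∧
    ∃ j ∈ D.coeff.support, ∀ i ∈ D.coeff.support, (τ i * (τ j)⁻¹) ^ k = 1}) ?_).2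
  obtain ⟨h0, τ, hτ, -⟩ := hD
  obtain ⟨j, hj⟩ := (Finsupp.support_nonempty_iff (f := D.coeff)).2 (by simpa using h0)
  have hpow : ∀ i, τ i ^ m = 1 := fun i => by
    rw [← AddChar.pow_apply, orderOf_dvd_iff_pow_eq_one.1 hτ.dvd, AddChar.one_apply]
  exact ⟨m, NeZero.pos m, τ, hτ, j, hj, fun i _ => by rw [mul_pow, inv_pow, hpow, hpow]; simp⟩

/-- If the reduced exponent of a minimal v-sum is coprime to `q`, where `m = M * q`, then the
`e`-th power of a character of order `m` kills it as soon as `e ≡ 1` modulo `M`. -/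
theorem IsMinimalVSum.charSum_pow_eq_zero [NeZero m] {A : NatGroupRing m} (hA : IsMinimalVSum A)
    {M q e : ℕ} (hm : M * q = m) (hk : (reducedExponent A).Coprime q) (he : e ≡ 1 [MOD M])
    {τ : AddChar (ZMod m) ℂ} (hτ : orderOf τ = m) : charSum (τ ^ e) A = 0 := by
  obtain ⟨σ, hσ, j, hj, hij⟩ := reducedExponent_spec hA
  have h0 : charSum τ A = 0 := by
    obtain ⟨-, τ', hτ', h, -⟩ := hA
    exact charSum_eq_zero_of_orderOf hτ' hτ h
  have hM : ∀ i ∈ A.coeff.support, τ (i - j) ^ M = 1 := by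
    intro i hi
    -- Faithfulness of `σ` makes the condition additive in `ZMod m`, hence usable for `τ`.
    have h1 : reducedExponent A • (i - j) = 0 := by
      apply eq_zero_of_addChar_eq_one hσ
      rw [AddChar.map_nsmul_eq_pow, AddChar.map_sub_eq_div, div_eq_mul_inv, hij i hi]
    have h2 : (M * q) • (i - j) = 0 := by simp [hm]
    have hd1 := addOrderOf_dvd_of_nsmul_eq_zero h1
    have hd2 := addOrderOf_dvd_of_nsmul_eq_zero h2
    have hd : addOrderOf (i - j) ∣ M := (Nat.Coprime.coprime_dvd_left hd1 hk).dvd_of_dvd_mul_right hd2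
    rw [← AddChar.map_nsmul_eq_pow, addOrderOf_dvd_iff_nsmul_eq_zero.1 hd,
      AddChar.map_zero_eq_one]
  have hpow : ∀ i ∈ A.coeff.support, τ (i - j) ^ e = τ (i - j) := by
    intro i hi
    rw [pow_eq_pow_mod e (hM i hi), he, ← pow_eq_pow_mod 1 (hM i hi), pow_one]
  have : charSum (τ ^ e) A = (τ j ^ e * τ (-j)) * charSum τ A := by
    simp only [charSum, Finsupp.sum, Finset.mul_sum]
    refine Finset.sum_congr rfl fun i hi => ?_
    have h1 : τ i = τ j * τ (i - j) := by rw [← AddChar.map_add_eq_mul]; simp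
    have h2 : τ (-j) * τ j = 1 := by rw [← AddChar.map_add_eq_mul]; simp
    rw [AddChar.pow_apply, h1, mul_pow, hpow i hi]
    linear_combination (-(A.coeff i : ℂ) * τ j ^ e * τ (i - j)) * h2
  rw [this, h0, mul_zero]

theorem charSum_pow_eq_zero_of_coprime_cExponent [NeZero m] {D : NatGroupRing m} (hD : IsVSum D)
    {M q e : ℕ} (hm : M * q = m) (hk : (cExponent D).Coprime q) (he : e ≡ 1 [MOD M])
    {τ : AddChar (ZMod m) ℂ} (hτ : orderOf τ = m) : charSum (τ ^ e) D = 0 := by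
  obtain ⟨s, hs, rfl, hlcm⟩ := Nat.sInf_mem (decompositionExponents_nonempty hD)
  rw [charSum_multiset_sum]
  refine Multiset.sum_eq_zero fun z hz => ?_
  obtain ⟨A, hA, rfl⟩ := Multiset.mem_map.1 hz
  refine (hs A hA).charSum_pow_eq_zero hm (Nat.Coprime.coprime_dvd_left ?_ hk) he hτ
  rw [cExponent, ← hlcm]
  exact Multiset.dvd_lcm (Multiset.mem_map_of_mem _ hA)

/-- Exponential sums of `#ι` terms: vanishing at the exponents `1, …, #ι` forces vanishing at the
exponent `0`. -/
theorem sum_eq_zero_of_sum_mul_pow_eq_zero {ι : Type*} [Fintype ι] (b z : ι → ℂ)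
    (hz : ∀ i, z i ≠ 0)
    (h : ∀ u, 1 ≤ u → u ≤ Fintype.card ι → ∑ i, b i * z i ^ u = 0) : ∑ i, b i = 0 := by
  let Q : ℂ[X] := ∏ i, (X - C (z i))
  have hdeg : Q.natDegree = Fintype.card ι := by
    simp [Q, natDegree_prod_of_monic _ _ fun i _ => monic_X_sub_C (z i)]
  have hQ0 : Q.coeff 0 ≠ 0 := by
    rw [coeff_zero_eq_eval_zero, eval_prod, Finset.prod_ne_zero_iff]
    simpa using hz
  have hQz : ∀ i, Q.eval (z i) = 0 := fun i => by
    rw [eval_prod]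
    exact Finset.prod_eq_zero (Finset.mem_univ i) (by simp)
  -- Expanding `Q` leaves only its constant coefficient, nonzero since no `z i` is; the `z i` need
  -- not be distinct.
  have h1 : ∑ i, b i * Q.eval (z i) = 0 := by simp [hQz]
  simp_rw [eval_eq_sum_range, hdeg, Finset.mul_sum] at h1
  rw [Finset.sum_comm, Finset.sum_range_succ', Finset.sum_eq_zero, zero_add] at h1
  · simp only [pow_zero, mul_one, ← Finset.sum_mul] at h1
    exact (mul_eq_zero.1 h1).resolve_right hQ0
  · intro u hu
    rw [Finset.mem_range] at hu
    have := h (u + 1) (by omega) (by omega)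
    calc ∑ i, b i * (Q.coeff (u + 1) * z i ^ (u + 1))
        = Q.coeff (u + 1) * ∑ i, b i * z i ^ (u + 1) := by
          rw [Finset.mul_sum]
          exact Finset.sum_congr rfl fun i _ => by ring
      _ = 0 := by rw [this, mul_zero]

theorem IsGBF.exists_isGBF_of_coprime_cExponent {f : Cube n → ZMod m} (hf : IsGBF m n f)
    {M q : ℕ} (hm : M * q = m) (hMq : M.Coprime q)
    (hk : ∀ x : Cube n, x ≠ 0 → (cExponent (E f x)).Coprime q) :
    ∃ f' : Cube n → ZMod M, IsGBF M n f' := by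
  have hm0 : m ≠ 0 := by have := hf.two_le; omega
  have : NeZero m := ⟨hm0⟩
  obtain ⟨τ, hτ, -⟩ := exists_addChar_of_isPrimitiveRoot
    (Complex.isPrimitiveRoot_exp m (NeZero.ne m))
  obtain ⟨e, he1, he0⟩ := Nat.chineseRemainder hMq 1 0
  refine exists_isGBF_of_addChar (left_ne_zero_of_mul (hm ▸ hm0)) hf.n_pos f (τ ^ e) ?_ ?_
  · rw [← pow_mul, ← orderOf_dvd_iff_pow_eq_one, hτ, ← hm, mul_comm]
    exact mul_dvd_mul_right ((Nat.modEq_zero_iff_dvd).1 he0) M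
  · intro x hx
    exact charSum_pow_eq_zero_of_coprime_cExponent ⟨τ, hτ, hf.charSum_E_eq_zero hτ hx⟩ hm
      (hk x hx) he1 hτ

theorem IsGBF.exists_isGBF_div_of_lt {f : Cube n → ZMod m} (hf : IsGBF m n f) {p : ℕ}
    (hp : p.Prime) (hpm : p ∣ m) (hlt : 2 ^ n < p) :
    ∃ f' : Cube n → ZMod (m / p), IsGBF (m / p) n f' := by
  have hm0 : m ≠ 0 := by have := hf.two_le; omega
  have : NeZero m := ⟨hm0⟩
  obtain ⟨τ, hτ, -⟩ := exists_addChar_of_isPrimitiveRoot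
    (Complex.isPrimitiveRoot_exp m (NeZero.ne m))
  obtain ⟨a, M, hpM, hm⟩ := Nat.exists_eq_pow_mul_and_not_dvd hm0 p hp.ne_one
  have ha : a ≠ 0 := by
    rintro rfl
    rw [pow_zero, one_mul] at hm
    exact hpM (hm ▸ hpm)
  have hcop : M.Coprime (p ^ a) := ((hp.coprime_iff_not_dvd.2 hpM).pow_left a).symm
  -- `τ ^ c` and `τ ^ d` are the prime-to-`p` and `p`-primary parts of `τ`.
  obtain ⟨c, hc1, hc0⟩ := Nat.chineseRemainder hcop 1 0
  obtain ⟨d, hd0, hd1⟩ := Nat.chineseRemainder hcop 0 1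
  have hcp : c ≡ 0 [MOD p] := hc0.of_dvd (dvd_pow_self p ha)
  have hdp : d ≡ 1 [MOD p] := hd1.of_dvd (dvd_pow_self p ha)
  refine exists_isGBF_of_addChar
    (Nat.div_pos (Nat.le_of_dvd (Nat.pos_of_ne_zero hm0) hpm) hp.pos).ne' hf.n_pos f (τ ^ c) ?_ ?_
  · rw [← pow_mul, ← orderOf_dvd_iff_pow_eq_one, hτ]
    nth_rewrite 1 [← Nat.mul_div_cancel' hpm]
    exact mul_dvd_mul_right ((Nat.modEq_zero_iff_dvd).1 hcp) _
  · intro x hx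
    rw [charSum_E]
    refine sum_eq_zero_of_sum_mul_pow_eq_zero _ (fun y => τ (f (y + x) - f y) ^ d)
      (fun y => pow_ne_zero _ (fun h0 => by simpa [h0] using addChar_mul_conj τ (f (y + x) - f y))) fun u hu1 hu => ?_
    have hup : u < p := lt_of_le_of_lt (by simpa [ZMod.card] using hu) hlt
    -- The exponent is `u` mod `p`, with `0 < u < p`, and `1` mod `M`; so this power of `τ` again
    -- has order `m`.
    have hcu : m.Coprime (c + u * d) := by
      rw [hm, Nat.coprime_mul_iff_left]
      constructor
      · refine Nat.Coprime.pow_left a (hp.coprime_iff_not_dvd.2 fun h => ?_)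
        have h1 : c + u * d ≡ 0 + u * 1 [MOD p] := hcp.add (hdp.mul_left u)
        rw [zero_add, mul_one] at h1
        have h2 := (h1.dvd_iff dvd_rfl).1 h
        exact absurd (Nat.le_of_dvd hu1 h2) (by omega)
      · have h1 : c + u * d ≡ 1 + u * 0 [MOD M] := hc1.add (hd0.mul_left u)
        rw [mul_zero, add_zero] at h1
        rw [Nat.coprime_comm, Nat.Coprime, h1.gcd_eq, Nat.gcd_one_left]
    have hord : orderOf (τ ^ (c + u * d)) = m := by
      rw [Nat.Coprime.orderOf_pow (by rwa [hτ]), hτ]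
    have h := hf.charSum_E_eq_zero hord hx
    rw [charSum_E] at h
    rw [← h]
    refine Finset.sum_congr rfl fun y _ => ?_
    rw [AddChar.pow_apply, AddChar.pow_apply, pow_add, mul_comm u d, pow_mul]

end Reduction

end GBF

theorem proposition3p1 (m n : ℕ) (f : GBF.Cube n → ZMod m) (hf : GBF.IsGBF m n f)
    (I : Finset ℕ)
    (hI : ∀ p : ℕ, p ∈ I ↔ p.Prime ∧ p ∣ m ∧
      ∀ x : GBF.Cube n, x ≠ 0 → ¬ p ∣ GBF.cExponent (GBF.E f x)) :
    (∃ f' : GBF.Cube n → ZMod (∏ p ∈ m.primeFactors \ I, p ^ m.factorization p),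
      GBF.IsGBF (∏ p ∈ m.primeFactors \ I, p ^ m.factorization p) n f') ∧
    ∀ p : ℕ, p.Prime → p ∣ m → 2 ^ n < p →
      ∃ f' : GBF.Cube n → ZMod (m / p), GBF.IsGBF (m / p) n f' := by
  refine ⟨?_, fun p hp hpm hlt => hf.exists_isGBF_div_of_lt hp hpm hlt⟩
  have hm0 : m ≠ 0 := by have := hf.two_le; omega
  have hsub : I ⊆ m.primeFactors := fun p hp =>
    Nat.mem_primeFactors.2 ⟨((hI p).1 hp).1, ((hI p).1 hp).2.1, hm0⟩
  refine hf.exists_isGBF_of_coprime_cExponent (q := ∏ p ∈ I, p ^ m.factorization p) ?_ ?_ ?_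
  · rw [Finset.prod_sdiff hsub]
    exact Nat.prod_factorization_pow_eq_self hm0
  · refine Nat.Coprime.prod_left fun p hp => Nat.Coprime.prod_right fun r hr => ?_
    obtain ⟨hp1, hp2⟩ := Finset.mem_sdiff.1 hp
    exact Nat.Coprime.pow _ _ ((Nat.coprime_primes (Nat.prime_of_mem_primeFactors hp1)
      ((hI r).1 hr).1).2 fun h => hp2 (h ▸ hr))
  · intro x hx
    refine Nat.Coprime.prod_right fun p hp => Nat.Coprime.pow_right _ ?_
    obtain ⟨h1, -, h3⟩ := (hI p).1 hp
    exact ((h1.coprime_iff_not_dvd).2 (h3 x hx)).symm
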